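/- **Theorem 2.1.** Let $\Omega\subseteq\mathbb{C}$ be open, let $n,k,j\ge 0$ and $m\ge 1$ be integers, and let $M_n(\Omega,m)$ denote the set of complex $n\times n$ matrices whose spectrum lies in $\Omega$ and whose largest Jordan block has size at most $m$. Let $x=(x_1,\dots,x_j)$ range over $\mathbb{K}^j$ with $\mathbb{K}=\mathbb{R}$ or $\mathbb{K}=\mathbb{C}$, let $\bar x\in\mathbb{K}^j$, and let $A(x)\in\mathbb{C}^{n\times n}$ be a matrix path that is $k$ times (Fréchet) differentiable at $\bar x$ (no condition if $k=0$) and satisfies $A(x)\in M_n(\Omega,m)$ for all $x$ in some neighborhood of $\bar x$. Let $f:\Omega\to\mathbb{C}$ be $(k+1)m-1$ times continuously (complex) differentiable on $\Omega$. For a square matrix $B$, the function $f$ is defined on the spectrum of $B$ if every eigenvalue $\lambda$ of $B$ lies in $\Omega$ and the derivatives $f^{(i)}(\lambda)$, $0\le i<n_\lambda$, exist, where $n_\lambda$ is the size of the largest Jordan block of $B$ with eigenvalue $\lambda$ (the multiplicity of $\lambda$ in the minimal polynomial of $B$). In that case $f(B):=p(B)$ for any polynomial $p$ with $p^{(i)}(\lambda)=f^{(i)}(\lambda)$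 for all eigenvalues $\lambda$ of $B$ and all $0\le i<n_\lambda$. Then $f(A(x))$ is $k$ times differentiable at $\bar x$. Moreover, for all $d_1,\dots,d_k\in\{1,\dots,j\}$, define $$X_0(x)=A(x),\qquad X_i(x)=\begin{bmatrix}X_{i-1}(x)&\frac{\partial}{\partial x_{d_i}}X_{i-1}(x)\\0&X_{i-1}(x)\end{bmatrix},\qquad i=1,\dots,k,$$ $$F_0(x)=f(A(x)),\qquad F_i(x)=\begin{bmatrix}F_{i-1}(x)&\frac{\partial}{\partial x_{d_i}}F_{i-1}(x)\\0&F_{i-1}(x)\end{bmatrix},\qquad i=1,\dots,k.$$ Then $f$ is defined on the spectrum of $X_k(\bar x)$ and $$f(X_k(\bar x))=F_k(\bar x).$$ In particular, the top-right $n\times n$ block of $f(X_k(\bar x))$ is the mixed partial derivative $$\left.\frac{\partial^k}{\partial x_{d_1}\cdots\partial x_{d_k}}f(A(x))\right|_{x=\bar x}.$$ -/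

import Mathlib

open Topology
open scoped Matrix.Norms.Operator

/-! ### Jordan blocks and the classes `M_n(Ω, m)` -/

/-- The `s × s` (upper) Jordan block with eigenvalue `lam`. -/
def jordanBlock (s : ℕ) (lam : ℂ) : Matrix (Fin s) (Fin s) ℂ :=
  Matrix.of fun p q => if p = q then lam else if (p : ℕ) + 1 = q then 1 else 0

/-- `A = P * diag(J_1, …, J_r) * P⁻¹` for some invertible `P`, where `J_i` is the Jordan block of
size `s i` with eigenvalue `lam i`. -/
def HasJordanForm {ι : Type*} [Fintype ι] [DecidableEq ι] (A : Matrix ι ι ℂ)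
    (r : ℕ) (s : Fin r → ℕ) (lam : Fin r → ℂ) : Prop :=
  ∃ (P : Matrix ι (Σ i, Fin (s i)) ℂ) (Q : Matrix (Σ i, Fin (s i)) ι ℂ),
    P * Q = 1 ∧ Q * P = 1 ∧
      A = P * Matrix.blockDiagonal' (fun i => jordanBlock (s i) (lam i)) * Q

/-- The set `M_n(Ω, m)` of complex matrices with spectrum in `Ω` and all Jordan blocks of size at
most `m`. -/
def jordanClass (ι : Type*) [Fintype ι] [DecidableEq ι] (Ω : Set ℂ) (m : ℕ) :
    Set (Matrix ι ι ℂ) :=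
  {A | spectrum ℂ A ⊆ Ω ∧
    ∃ (r : ℕ) (s : Fin r → ℕ) (lam : Fin r → ℂ), HasJordanForm A r s lam ∧ ∀ i, s i ≤ m}

/-! ### Differentiability of order `k` at a point -/

/-- `g` is `k` times (Fréchet) differentiable at the point `x`: the derivatives of order less than
`k - 1` are differentiable in a neighbourhood of `x`, and the derivative of order `k - 1` is
differentiable at `x`. Nothing is required for `k = 0`. -/
def TimesDifferentiableAt (𝕜 : Type*) [NontriviallyNormedField 𝕜]
    {E : Type*} [NormedAddCommGroup E] [NormedSpace 𝕜 E]
    {F : Type*} [NormedAddCommGroup F] [NormedSpace 𝕜 F]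
    (k : ℕ) (g : E → F) (x : E) : Prop :=
  (∀ i, i + 1 < k → ∀ᶠ y in 𝓝 x, DifferentiableAt 𝕜 (iteratedFDeriv 𝕜 i g) y) ∧
    ∀ i, i + 1 = k → DifferentiableAt 𝕜 (iteratedFDeriv 𝕜 i g) x

/-! ### Matrix functions, by Hermite interpolation on the spectrum -/

/-- The multiplicity of `lam` as a root of the minimal polynomial of `A`; for an eigenvalue, this is
the size of the largest Jordan block of `A` in which it appears. -/
noncomputable def eigIndex {ι : Type*} [Fintype ι] [DecidableEq ι] (A : Matrix ι ι ℂ) (lam : ℂ) :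
    ℕ :=
  (minpoly ℂ A).rootMultiplicity lam

/-- The polynomial `p` interpolates `f` on the spectrum of `A`: it agrees with `f` at each
eigenvalue, together with the derivatives of order less than the index of the eigenvalue. -/
def InterpolatesOnSpectrum {ι : Type*} [Fintype ι] [DecidableEq ι] (f : ℂ → ℂ) (A : Matrix ι ι ℂ)
    (p : Polynomial ℂ) : Prop :=
  ∀ lam ∈ spectrum ℂ A, ∀ i < eigIndex A lam,
    (Polynomial.derivative^[i] p).eval lam = iteratedDeriv i f lam

/-- The function `f`, given on `Ω`, is defined on the spectrum of `A`: the eigenvalues of `A` lie in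
`Ω`, and at each eigenvalue the derivatives of `f` of order less than its index exist. -/
def DefinedOnSpectrum {ι : Type*} [Fintype ι] [DecidableEq ι] (Ω : Set ℂ) (f : ℂ → ℂ)
    (A : Matrix ι ι ℂ) : Prop :=
  spectrum ℂ A ⊆ Ω ∧ ∀ lam ∈ spectrum ℂ A, TimesDifferentiableAt ℂ (eigIndex A lam - 1) f lam

theorem eval_iterate_derivative_eq_coeff_taylor (p : Polynomial ℂ) (a : ℂ) (i : ℕ) :
    (Polynomial.derivative^[i] p).eval a = (i.factorial : ℂ) * (p.taylor a).coeff i := by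
  rw [Polynomial.taylor_coeff, ← Polynomial.factorial_smul_hasseDeriv]
  simp

theorem pow_sub_dvd_iff_derivative (p : Polynomial ℂ) (a : ℂ) (k : ℕ) :
    (Polynomial.X - Polynomial.C a) ^ k ∣ p ↔
      ∀ i < k, (Polynomial.derivative^[i] p).eval a = 0 := by
  have h1 : (Polynomial.X - Polynomial.C a) ^ k ∣ p ↔ Polynomial.X ^ k ∣ p.taylor a := by
    rw [← map_dvd_iff (Polynomial.taylorEquiv a)]
    simp [Polynomial.taylor_pow, Polynomial.taylorEquiv]
  rw [h1, Polynomial.X_pow_dvd_iff]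
  simp [eval_iterate_derivative_eq_coeff_taylor, Nat.factorial_ne_zero]

/-- An interpolating polynomial exists. -/
theorem exists_interpolatesOnSpectrum {ι : Type*} [Fintype ι] [DecidableEq ι] (f : ℂ → ℂ)
    (A : Matrix ι ι ℂ) : ∃ p : Polynomial ℂ, InterpolatesOnSpectrum f A p := by
  classical
  have hfin : (spectrum ℂ A).Finite := Matrix.finite_spectrum A
  have := hfin.to_subtype
  let q : spectrum ℂ A → Polynomial ℂ := fun a =>
    Polynomial.taylor (-(a : ℂ)) (∑ i ∈ Finset.range (eigIndex A a),
      Polynomial.monomial i (iteratedDeriv i f a / (i.factorial : ℂ)))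
  have hcop : Pairwise (Function.onFun IsCoprime fun a : spectrum ℂ A =>
      Ideal.span {(Polynomial.X - Polynomial.C (a : ℂ)) ^ eigIndex A a}) := by
    intro a b hab
    rw [Function.onFun, Ideal.isCoprime_span_singleton_iff]
    exact (Polynomial.isCoprime_X_sub_C_of_isUnit_sub
      (sub_ne_zero.mpr fun h => hab (Subtype.ext h)).isUnit).pow
  obtain ⟨p, hp⟩ := Ideal.exists_forall_sub_mem_ideal hcop q
  refine ⟨p, fun a ha i hi => ?_⟩
  have h := (pow_sub_dvd_iff_derivative _ _ _).1
    (Ideal.mem_span_singleton.1 (hp ⟨a, ha⟩)) i hi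
  rw [Polynomial.iterate_derivative_sub, Polynomial.eval_sub, sub_eq_zero] at h
  rw [h, eval_iterate_derivative_eq_coeff_taylor, Polynomial.taylor_taylor]
  have : (i.factorial : ℂ) ≠ 0 := by exact_mod_cast Nat.factorial_ne_zero i
  simp [Polynomial.coeff_monomial, hi]
  field_simp

/-- The value at `A` does not depend on the interpolating polynomial. -/
theorem aeval_eq_of_interpolatesOnSpectrum {ι : Type*} [Fintype ι] [DecidableEq ι] (f : ℂ → ℂ)
    (A : Matrix ι ι ℂ) (p q : Polynomial ℂ) (hp : InterpolatesOnSpectrum f A p)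
    (hq : InterpolatesOnSpectrum f A q) : Polynomial.aeval A p = Polynomial.aeval A q := by
  rw [← sub_eq_zero, ← map_sub, ← minpoly.dvd_iff]
  by_cases h0 : p - q = 0
  · simp [h0]
  have hm : minpoly ℂ A ≠ 0 := minpoly.ne_zero (Matrix.isIntegral A)
  have hs := IsAlgClosed.splits (minpoly ℂ A)
  rw [Polynomial.Splits.dvd_iff_roots_le_roots hs hm h0, Multiset.le_iff_count]
  intro a
  rw [Polynomial.count_roots, Polynomial.count_roots,
    Polynomial.le_rootMultiplicity_iff h0, pow_sub_dvd_iff_derivative]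
  intro i hi
  have ha : a ∈ spectrum ℂ A := by
    rw [← AlgEquiv.spectrum_eq (Matrix.toLinAlgEquiv' (R := ℂ) (n := ι)) A,
      ← Module.End.hasEigenvalue_iff_mem_spectrum, Module.End.hasEigenvalue_iff_isRoot,
      minpoly.algEquiv_eq]
    exact (Polynomial.rootMultiplicity_pos hm).1 (lt_of_le_of_lt (Nat.zero_le i) hi)
  rw [Polynomial.iterate_derivative_sub, Polynomial.eval_sub, hp a ha i hi, hq a ha i hi, sub_self]

/-- The matrix function `f(A)`: the value at `A` of any polynomial that interpolates `f` on the
spectrum of `A`. It is meaningful when `f` is defined on the spectrum of `A`. -/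
noncomputable def matFun {ι : Type*} [Fintype ι] [DecidableEq ι] (f : ℂ → ℂ) (A : Matrix ι ι ℂ) :
    Matrix ι ι ℂ :=
  Polynomial.aeval A (exists_interpolatesOnSpectrum f A).choose

/-! ### Partial derivatives and the recursive block matrices -/

/-- The partial derivative `∂g/∂x_d`, as a function of `x`. -/
noncomputable def partialDeriv (𝕜 : Type*) [NontriviallyNormedField 𝕜] {j : ℕ}
    {F : Type*} [NormedAddCommGroup F] [NormedSpace 𝕜 F]
    (d : Fin j) (g : (Fin j → 𝕜) → F) : (Fin j → 𝕜) → F :=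
  fun x => lineDeriv 𝕜 g x (Pi.single d 1)

/-- The mixed partial derivative `∂^k g/∂x_{d 0} ⋯ ∂x_{d (k-1)} = ∂_{d 0} (⋯ (∂_{d (k-1)} g))`. -/
noncomputable def mixedPartial (𝕜 : Type*) [NontriviallyNormedField 𝕜] {j : ℕ}
    {F : Type*} [NormedAddCommGroup F] [NormedSpace 𝕜 F] :
    (k : ℕ) → (Fin k → Fin j) → ((Fin j → 𝕜) → F) → (Fin j → 𝕜) → F
  | 0, _, g => g
  | k + 1, d, g => partialDeriv 𝕜 (d 0) (mixedPartial 𝕜 k (Fin.tail d) g)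

/-- The index set of a matrix made of `2^k × 2^k` blocks, each indexed by `ι`. -/
def BlockIndex (ι : Type) : ℕ → Type
  | 0 => ι
  | k + 1 => BlockIndex ι k ⊕ BlockIndex ι k

instance BlockIndex.instFintype (ι : Type) [Fintype ι] : (k : ℕ) → Fintype (BlockIndex ι k)
  | 0 => inferInstanceAs (Fintype ι)
  | k + 1 =>
    haveI := BlockIndex.instFintype ι k
    inferInstanceAs (Fintype (BlockIndex ι k ⊕ BlockIndex ι k))

instance BlockIndex.instDecidableEq (ι : Type) [DecidableEq ι] :
    (k : ℕ) → DecidableEq (BlockIndex ι k)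
  | 0 => inferInstanceAs (DecidableEq ι)
  | k + 1 =>
    haveI := BlockIndex.instDecidableEq ι k
    inferInstanceAs (DecidableEq (BlockIndex ι k ⊕ BlockIndex ι k))

/-- The index `p` in the first of the `2^k` blocks. -/
def BlockIndex.first {ι : Type} : (k : ℕ) → ι → BlockIndex ι k
  | 0, p => p
  | k + 1, p => Sum.inl (BlockIndex.first k p)

/-- The index `p` in the last of the `2^k` blocks. -/
def BlockIndex.last {ι : Type} : (k : ℕ) → ι → BlockIndex ι k
  | 0, p => p
  | k + 1, p => Sum.inr (BlockIndex.last k p)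

/-- The recursive block matrices `Y_0 = G` and `Y_i = [[Y_{i-1}, ∂Y_{i-1}/∂x_{d_i}], [0, Y_{i-1}]]`,
where the directions `d_1, …, d_k` are `d 0, …, d (k-1)`; this is `Y_k`. -/
noncomputable def blockSeq (𝕜 : Type*) [RCLike 𝕜] [NormedAlgebra 𝕜 ℂ] {j : ℕ}
    {ι : Type} [Fintype ι] :
    (k : ℕ) → (Fin k → Fin j) → ((Fin j → 𝕜) → Matrix ι ι ℂ) →
      (Fin j → 𝕜) → Matrix (BlockIndex ι k) (BlockIndex ι k) ℂ
  | 0, _, G => G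
  | k + 1, d, G => fun x =>
      Matrix.fromBlocks (blockSeq 𝕜 k (Fin.init d) G x)
        (partialDeriv 𝕜 (d (Fin.last k)) (blockSeq 𝕜 k (Fin.init d) G) x)
        0 (blockSeq 𝕜 k (Fin.init d) G x)

/-!
Unless `(k + 1) m - 1 = 0`, the function `f` is holomorphic on `Ω`, so that the smoothness of
`B ↦ f(B)` does not depend on the sizes of the Jordan blocks.

Dividing by the linear factors `z - a` one at a time writes `f = p + h g` with `p` a polynomial, `h`
any prescribed product of such factors with nodes in `Ω`, and `g` holomorphic on `Ω`
(`exists_eq_eval_add_prod_mul`). If `h(B) = 0`, then `p` interpolates `f` on the spectrum of `B`, so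
`f(B) = p(B)` (`matFun_eq_aeval_of_eq_add_mul`). By the maximum principle the divided differences
that occur as coefficients of `p` are bounded by the supremum of `|f|` on a neighbourhood of the
nodes, even if the nodes collide; hence `B ↦ f(B)` is locally bounded
(`exists_eventually_norm_matFun_le`).

Now take `h = χ²`, with `χ` the characteristic polynomial of `B`. For `X` near `B`, the difference
`f(X) - p(X) = χ(X)² g(X)` is `O(‖X - B‖²)`, so `f` is differentiable at `B` with the derivative of
`p`. The matrix `[[B, E], [0, B]]` is annihilated by `χ²`, so `f` and `p` agree on it, and the upper
right block of `p([[B, E], [0, B]])` is the derivative of `p` at `B` in the direction `E`. Thus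
`f([[B, E], [0, B]]) = [[f(B), Df(B) E], [0, f(B)]]` (`exists_hasFDerivAt_matFun`).

Along a path `A`, this says that `∂f(A)/∂x_d` is a block of `f` at the path `[[A, ∂A/∂x_d], [0, A]]`
of matrices of twice the size, and both the differentiability of order `k`
(`TimesDifferentiableAt.matFun_comp`) and the identity for the recursive block matrices
(`matFun_blockSeq`) follow by induction on `k`. The upper right block is a mixed partial derivative
in the reversed order of directions; second derivatives are symmetric
(`mixedPartial_succ_eq_partialDeriv_last`).

In the remaining case `k = 0` and `m = 1`, all that is to be shown is that the eigenvalues have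
index at most one, which holds because `A` is diagonalizable (`eigIndex_le_one_of_mem_jordanClass`).
-/

/-! ### Newton interpolation of holomorphic functions -/

/-- Newton interpolation: dividing a holomorphic function by `∏ (z - a)`, `a ∈ s`, leaves a
polynomial remainder. -/
theorem exists_eq_eval_add_prod_mul {Ω : Set ℂ} (hΩ : IsOpen Ω) {f : ℂ → ℂ}
    (hf : DifferentiableOn ℂ f Ω) (s : Multiset ℂ) (hs : ∀ a ∈ s, a ∈ Ω) :
    ∃ (p : Polynomial ℂ) (g : ℂ → ℂ), DifferentiableOn ℂ g Ω ∧ ∀ z, f z = p.eval z +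
      (s.map fun a => Polynomial.X - Polynomial.C a).prod.eval z * g z := by
  induction s using Multiset.induction_on with
  | empty => exact ⟨0, f, hf, by simp⟩
  | cons a s ih =>
    obtain ⟨p, g, hg, h⟩ := ih fun b hb => hs b (Multiset.mem_cons_of_mem hb)
    have ha : a ∈ Ω := hs a (Multiset.mem_cons_self a s)
    refine ⟨p + (s.map fun a => Polynomial.X - Polynomial.C a).prod * Polynomial.C (g a),
      dslope g a, (Complex.differentiableOn_dslope (hΩ.mem_nhds ha)).2 hg, fun z => ?_⟩
    have hz := sub_smul_dslope g a z
    rw [smul_eq_mul] at hz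
    rw [h z, Multiset.map_cons, Multiset.prod_cons]
    simp only [Polynomial.eval_add, Polynomial.eval_mul, Polynomial.eval_sub, Polynomial.eval_X,
      Polynomial.eval_C]
    linear_combination
      -(s.map fun a => Polynomial.X - Polynomial.C a).prod.eval z * hz

/-- The divided difference of a function bounded by `M` on a neighbourhood of radius `δ` of the
base point is bounded by `2 M / δ`; near the base point, this is the maximum principle. -/
theorem norm_dslope_le {Ω K : Set ℂ} (hKΩ : K ⊆ Ω) (hΩ : IsOpen Ω) {g : ℂ → ℂ}
    (hg : DifferentiableOn ℂ g Ω) {a : ℂ} {δ M : ℝ} (hδ : 0 < δ)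
    (ha : Metric.closedBall a δ ⊆ K) (hM : ∀ z ∈ K, ‖g z‖ ≤ M) {z : ℂ} (hz : z ∈ K) :
    ‖dslope g a z‖ ≤ M * (2 / δ) := by
  have haK : a ∈ K := ha (Metric.mem_closedBall_self hδ.le)
  have far : ∀ w ∈ K, δ ≤ ‖w - a‖ → ‖dslope g a w‖ ≤ M * (2 / δ) := by
    intro w hw hwa
    have h := congrArg norm (sub_smul_dslope g a w)
    rw [norm_smul] at h
    have h1 : ‖g w - g a‖ ≤ M + M := (norm_sub_le _ _).trans (add_le_add (hM w hw) (hM a haK))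
    have h2 : δ * ‖dslope g a w‖ ≤ M + M :=
      (mul_le_mul_of_nonneg_right hwa (norm_nonneg _)).trans (h.trans_le h1)
    rw [mul_div_assoc', le_div_iff₀ hδ]
    linarith
  by_cases hza : δ ≤ ‖z - a‖
  · exact far z hz hza
  have hd : DifferentiableOn ℂ (dslope g a) Ω :=
    (Complex.differentiableOn_dslope (hΩ.mem_nhds (hKΩ haK))).2 hg
  refine Complex.norm_le_of_forall_mem_frontier_norm_le (U := Metric.ball a δ)
    Metric.isBounded_ball (DifferentiableOn.diffContOnCl ?_) (fun w hw => ?_) (subset_closure ?_)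
  · rw [closure_ball a hδ.ne']
    exact hd.mono (ha.trans hKΩ)
  · rw [frontier_ball a hδ.ne'] at hw
    refine far w (ha (Metric.sphere_subset_closedBall hw)) ?_
    rw [← dist_eq_norm, Metric.mem_sphere.1 hw]
  · rw [Metric.mem_ball, dist_eq_norm]
    exact not_le.1 hza

/-- The value of the Newton interpolant at a matrix is bounded in terms of a bound for the function,
uniformly in the matrix and in the nodes. The nodes may collide. -/
theorem exists_newton_interpolant_norm_aeval_le {ι : Type*} [Fintype ι] [DecidableEq ι]
    {Ω K S : Set ℂ} (hΩ : IsOpen Ω) (hKΩ : K ⊆ Ω) {δ R : ℝ} (hδ : 0 < δ)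
    (hSK : ∀ a ∈ S, Metric.closedBall a δ ⊆ K) (hSR : ∀ a ∈ S, ‖a‖ ≤ R) (N : ℕ) :
    ∃ c : ℝ, ∀ s : Multiset ℂ, Multiset.card s = N → (∀ a ∈ s, a ∈ S) →
      ∀ (M : ℝ) (g : ℂ → ℂ), DifferentiableOn ℂ g Ω → (∀ z ∈ K, ‖g z‖ ≤ M) →
        ∃ (p : Polynomial ℂ) (h : ℂ → ℂ), DifferentiableOn ℂ h Ω ∧ (∀ z, g z = p.eval z +
          (s.map fun a => Polynomial.X - Polynomial.C a).prod.eval z * h z) ∧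
          ∀ B : Matrix ι ι ℂ, ‖B‖ ≤ R → ‖Polynomial.aeval B p‖ ≤ c * M := by
  induction N with
  | zero =>
    refine ⟨0, fun s hs _ M g hg _ => ⟨0, g, hg, ?_, ?_⟩⟩
    · simp [Multiset.card_eq_zero.1 hs]
    · simp
  | succ N ih =>
    obtain ⟨c, hc⟩ := ih
    refine ⟨‖(1 : Matrix ι ι ℂ)‖ + (R + R * ‖(1 : Matrix ι ι ℂ)‖) * (c * (2 / δ)), ?_⟩
    intro s hs hsS M g hg hM
    obtain ⟨a, has⟩ : ∃ a, a ∈ s := Multiset.card_pos_iff_exists_mem.1 (hs ▸ Nat.succ_pos N)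
    obtain ⟨t, rfl⟩ := Multiset.exists_cons_of_mem has
    have ht : Multiset.card t = N := by simpa using hs
    have ha : a ∈ S := hsS a (Multiset.mem_cons_self a t)
    have haK : a ∈ K := hSK a ha (Metric.mem_closedBall_self hδ.le)
    obtain ⟨p, h, hh, hgp, hp⟩ := hc t ht (fun b hb => hsS b (Multiset.mem_cons_of_mem hb))
      (M * (2 / δ)) (dslope g a)
      ((Complex.differentiableOn_dslope (hΩ.mem_nhds (hKΩ haK))).2 hg)
      (fun z hz => norm_dslope_le hKΩ hΩ hg hδ (hSK a ha) hM hz)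
    refine ⟨Polynomial.C (g a) + (Polynomial.X - Polynomial.C a) * p, h, hh, fun z => ?_, ?_⟩
    · have hz := sub_smul_dslope g a z
      rw [smul_eq_mul, hgp z] at hz
      rw [Multiset.map_cons, Multiset.prod_cons]
      simp only [Polynomial.eval_add, Polynomial.eval_mul, Polynomial.eval_sub, Polynomial.eval_X,
        Polynomial.eval_C]
      linear_combination -hz
    · intro B hB
      simp only [map_add, map_mul, map_sub, Polynomial.aeval_C, Polynomial.aeval_X,
        Algebra.algebraMap_eq_smul_one]
      have h1 : ‖g a • (1 : Matrix ι ι ℂ)‖ ≤ M * ‖(1 : Matrix ι ι ℂ)‖ := by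
        rw [norm_smul]
        exact mul_le_mul_of_nonneg_right (hM a haK) (norm_nonneg _)
      have h2 : ‖B - a • (1 : Matrix ι ι ℂ)‖ ≤ R + R * ‖(1 : Matrix ι ι ℂ)‖ := by
        refine (norm_sub_le _ _).trans (add_le_add hB ?_)
        rw [norm_smul]
        exact mul_le_mul_of_nonneg_right (hSR a ha) (norm_nonneg _)
      have h3 := mul_le_mul h2 (hp B hB) (norm_nonneg _) ((norm_nonneg _).trans h2)
      refine (norm_add_le _ _).trans ((add_le_add h1 ((norm_mul_le _ _).trans h3)).trans_eq ?_)
      ring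

/-! ### Algebra of matrix functions -/

theorem iteratedDeriv_polynomial_eval (p : Polynomial ℂ) (i : ℕ) :
    iteratedDeriv i (fun z => p.eval z) = fun z => (Polynomial.derivative^[i] p).eval z := by
  induction i with
  | zero => simp
  | succ i ih =>
    rw [iteratedDeriv_succ, ih, Function.iterate_succ_apply']
    funext z
    exact Polynomial.deriv _

/-- If `f = p + h g` with `h(B) = 0`, then `p` interpolates `f` on the spectrum of `B`, since the
minimal polynomial of `B` divides `h`. -/
theorem matFun_eq_aeval_of_eq_add_mul {ι : Type*} [Fintype ι] [DecidableEq ι] {Ω : Set ℂ}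
    (hΩ : IsOpen Ω) {f g : ℂ → ℂ} (hg : DifferentiableOn ℂ g Ω) {B : Matrix ι ι ℂ}
    (hB : spectrum ℂ B ⊆ Ω) {p h : Polynomial ℂ} (hh : Polynomial.aeval B h = 0)
    (hfp : ∀ z, f z = p.eval z + h.eval z * g z) : matFun f B = Polynomial.aeval B p := by
  refine aeval_eq_of_interpolatesOnSpectrum f B _ _ (exists_interpolatesOnSpectrum f B).choose_spec
    fun a ha i hi => ?_
  have hgA : AnalyticAt ℂ g a := hg.analyticAt (hΩ.mem_nhds (hB ha))
  have hpoly : ∀ q : Polynomial ℂ, AnalyticAt ℂ (fun z => q.eval z) a := fun q =>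
    q.differentiable.analyticAt a
  obtain ⟨r, hr⟩ : (Polynomial.X - Polynomial.C a) ^ eigIndex B a ∣ h :=
    (Polynomial.pow_rootMultiplicity_dvd _ a).trans (minpoly.dvd ℂ B hh)
  have hf' : f = (fun z => p.eval z) + fun z => h.eval z * g z := funext hfp
  have hzero : iteratedDeriv i (fun z => h.eval z * g z) a = 0 := by
    refine (natCast_le_analyticOrderAt_iff_iteratedDeriv_eq_zero ((hpoly h).mul hgA)).1
      ((natCast_le_analyticOrderAt ((hpoly h).mul hgA)).2
        ⟨fun z => r.eval z * g z, (hpoly r).mul hgA, .of_forall fun z => ?_⟩) i hi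
    simp [hr, mul_assoc]
  rw [hf', iteratedDeriv_add (hpoly p).contDiffAt
    (show AnalyticAt ℂ (fun z => h.eval z * g z) a from (hpoly h).mul hgA).contDiffAt,
    hzero, add_zero, iteratedDeriv_polynomial_eval]

theorem prod_X_sub_C_roots_charpoly {ι : Type*} [Fintype ι] [DecidableEq ι] (B : Matrix ι ι ℂ) :
    (B.charpoly.roots.map fun a => Polynomial.X - Polynomial.C a).prod = B.charpoly :=
  ((IsAlgClosed.splits B.charpoly).eq_prod_roots_of_monic B.charpoly_monic).symm

theorem mem_spectrum_of_mem_roots_charpoly {ι : Type*} [Fintype ι] [DecidableEq ι]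
    {B : Matrix ι ι ℂ} {a : ℂ} (ha : a ∈ B.charpoly.roots) : a ∈ spectrum ℂ B :=
  Matrix.mem_spectrum_iff_isRoot_charpoly.2 (Polynomial.isRoot_of_mem_roots ha)

theorem matFun_eq_aeval_add_mul {ι : Type*} [Fintype ι] [DecidableEq ι] {Ω : Set ℂ}
    (hΩ : IsOpen Ω) {f g : ℂ → ℂ} (hg : DifferentiableOn ℂ g Ω) {B : Matrix ι ι ℂ}
    (hB : spectrum ℂ B ⊆ Ω) {p h : Polynomial ℂ} (hfp : ∀ z, f z = p.eval z + h.eval z * g z) :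
    matFun f B = Polynomial.aeval B p + Polynomial.aeval B h * matFun g B := by
  obtain ⟨q, r, hr, hgq⟩ := exists_eq_eval_add_prod_mul hΩ hg B.charpoly.roots
    fun a ha => hB (mem_spectrum_of_mem_roots_charpoly ha)
  rw [prod_X_sub_C_roots_charpoly] at hgq
  rw [matFun_eq_aeval_of_eq_add_mul hΩ hr hB B.aeval_self_charpoly hgq,
    matFun_eq_aeval_of_eq_add_mul hΩ hr hB (p := p + h * q) (h := h * B.charpoly)
      (by rw [map_mul, B.aeval_self_charpoly, mul_zero])
      (fun z => by rw [hfp z, hgq z, Polynomial.eval_add, Polynomial.eval_mul,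
        Polynomial.eval_mul]; ring)]
  simp

/-! ### Differentiability of matrix functions -/

theorem eventually_spectrum_subset {ι : Type*} [Fintype ι] [DecidableEq ι] {Ω : Set ℂ}
    (hΩ : IsOpen Ω) {B : Matrix ι ι ℂ} (hB : spectrum ℂ B ⊆ Ω) :
    ∀ᶠ X in 𝓝 B, spectrum ℂ X ⊆ Ω :=
  upperHemicontinuous_iff_forall_isOpen.1 (upperHemicontinuous_spectrum ℂ (Matrix ι ι ℂ)) B Ω hΩ hB

/-- Matrix functions of a holomorphic function are locally bounded. -/
theorem exists_eventually_norm_matFun_le {ι : Type*} [Fintype ι] [DecidableEq ι] {Ω : Set ℂ}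
    (hΩ : IsOpen Ω) {g : ℂ → ℂ} (hg : DifferentiableOn ℂ g Ω) {B : Matrix ι ι ℂ}
    (hB : spectrum ℂ B ⊆ Ω) : ∃ c : ℝ, ∀ᶠ X in 𝓝 B, ‖matFun g X‖ ≤ c := by
  have hcomp : IsCompact (spectrum ℂ B) := spectrum.isCompact B
  obtain ⟨ε, hε, hεΩ⟩ := hcomp.exists_cthickening_subset_open hΩ hB
  have hK : IsCompact (Metric.cthickening ε (spectrum ℂ B)) := hcomp.cthickening
  obtain ⟨M, hM⟩ := hK.exists_bound_of_continuousOn (hg.continuousOn.mono hεΩ)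
  -- the nodes range over the thickening of radius `ε / 2`
  have hSK : ∀ a ∈ Metric.thickening (ε / 2) (spectrum ℂ B),
      Metric.closedBall a (ε / 2) ⊆ Metric.cthickening ε (spectrum ℂ B) := by
    intro a ha z hz
    obtain ⟨b, hb, hab⟩ := Metric.mem_thickening_iff.1 ha
    refine Metric.mem_cthickening_of_dist_le z b ε _ hb ?_
    have := dist_triangle z a b
    have := Metric.mem_closedBall.1 hz
    linarith
  obtain ⟨R₀, hR₀⟩ := hK.isBounded.exists_norm_le
  have hSR : ∀ a ∈ Metric.thickening (ε / 2) (spectrum ℂ B), ‖a‖ ≤ max R₀ (‖B‖ + 1) :=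
    fun a ha => (hR₀ a (hSK a ha (Metric.mem_closedBall_self (by positivity)))).trans
      (le_max_left _ _)
  obtain ⟨c, hc⟩ := exists_newton_interpolant_norm_aeval_le (ι := ι) hΩ hεΩ (half_pos hε) hSK hSR
    (Fintype.card ι)
  refine ⟨c * M, ?_⟩
  have hnorm : ∀ᶠ X in 𝓝 B, ‖X‖ < ‖B‖ + 1 :=
    continuous_norm.continuousAt.eventually_lt continuousAt_const (lt_add_one _)
  filter_upwards [eventually_spectrum_subset Metric.isOpen_thickening
    (Metric.self_subset_thickening (half_pos hε) (spectrum ℂ B)), hnorm] with X hX hXn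
  have hXΩ : spectrum ℂ X ⊆ Ω := fun a ha =>
    hεΩ (hSK a (hX ha) (Metric.mem_closedBall_self (by positivity)))
  have hcard : Multiset.card X.charpoly.roots = Fintype.card ι := by
    rw [← (IsAlgClosed.splits X.charpoly).natDegree_eq_card_roots, X.charpoly_natDegree_eq_dim]
  obtain ⟨p, h, hh, hgp, hp⟩ := hc X.charpoly.roots hcard
    (fun a ha => hX (mem_spectrum_of_mem_roots_charpoly ha)) M g hg hM
  rw [prod_X_sub_C_roots_charpoly] at hgp
  rw [matFun_eq_aeval_of_eq_add_mul hΩ hh hXΩ X.aeval_self_charpoly hgp]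
  exact hp X (hXn.le.trans (le_max_right _ _))

/-- The derivative of a polynomial at a matrix is read off from the upper right block of its value
at a block triangular matrix. -/
theorem exists_hasFDerivAt_aeval {ι : Type*} [Fintype ι] [DecidableEq ι] (p : Polynomial ℂ)
    (B : Matrix ι ι ℂ) : ∃ L : Matrix ι ι ℂ →L[ℂ] Matrix ι ι ℂ,
      HasFDerivAt (fun X => Polynomial.aeval X p) L B ∧ ∀ E,
        Polynomial.aeval (Matrix.fromBlocks B E 0 B) p =
          Matrix.fromBlocks (Polynomial.aeval B p) (L E) 0 (Polynomial.aeval B p) := by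
  induction p using Polynomial.induction_on with
  | C a =>
    refine ⟨0, ?_, fun E => ?_⟩
    · simpa using hasFDerivAt_const _ B
    · rw [Polynomial.aeval_C, Polynomial.aeval_C, Algebra.algebraMap_eq_smul_one,
        Algebra.algebraMap_eq_smul_one, ← Matrix.fromBlocks_one, Matrix.fromBlocks_smul]
      simp
  | add p q hp hq =>
    obtain ⟨L, hL, hL'⟩ := hp
    obtain ⟨L₂, hL₂, hL₂'⟩ := hq
    refine ⟨L + L₂, ?_, fun E => ?_⟩
    · simp only [map_add]
      exact hL.add hL₂
    · rw [map_add, hL', hL₂', Matrix.fromBlocks_add]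
      simp
  | monomial n a ih =>
    obtain ⟨L, hL, hL'⟩ := ih
    have hp : Polynomial.C a * Polynomial.X ^ (n + 1) =
        Polynomial.C a * Polynomial.X ^ n * Polynomial.X := by ring
    rw [hp]
    have h := hL.mul' (hasFDerivAt_id B)
    refine ⟨_, by
      simp only [map_mul (Polynomial.aeval _) _ Polynomial.X, Polynomial.aeval_X]
      exact h, fun E => ?_⟩
    rw [map_mul (Polynomial.aeval _) _ Polynomial.X, hL',
      map_mul (Polynomial.aeval _) _ Polynomial.X, Polynomial.aeval_X, Polynomial.aeval_X,
      Matrix.fromBlocks_multiply]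
    simp only [mul_zero, zero_mul, add_zero, zero_add]
    rfl

theorem spectrum_fromBlocks_subset {ι : Type*} [Fintype ι] [DecidableEq ι] (B E : Matrix ι ι ℂ) :
    spectrum ℂ (Matrix.fromBlocks B E 0 B) ⊆ spectrum ℂ B := by
  intro a ha
  rw [Matrix.mem_spectrum_iff_isRoot_charpoly, Matrix.charpoly_fromBlocks_zero₂₁,
    Polynomial.root_mul, or_self] at ha
  exact Matrix.mem_spectrum_iff_isRoot_charpoly.2 ha

/-- Write `f = p + χ² g` with `χ` the characteristic polynomial of `B`. Then
`f(X) - p(X) = χ(X)² g(X)` is quadratically small near `B`, so that `f` has the same derivative at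
`B` as `p`, and `χ²` annihilates `[[B, E], [0, B]]`, so that `f` and `p` have the same value
there. -/
theorem exists_hasFDerivAt_matFun {ι : Type*} [Fintype ι] [DecidableEq ι] {Ω : Set ℂ}
    (hΩ : IsOpen Ω) {f : ℂ → ℂ} (hf : DifferentiableOn ℂ f Ω) {B : Matrix ι ι ℂ}
    (hB : spectrum ℂ B ⊆ Ω) : ∃ L : Matrix ι ι ℂ →L[ℂ] Matrix ι ι ℂ,
      HasFDerivAt (matFun f) L B ∧ ∀ E, matFun f (Matrix.fromBlocks B E 0 B) =
          Matrix.fromBlocks (matFun f B) (L E) 0 (matFun f B) := by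
  have hroots : ∀ a ∈ B.charpoly.roots, a ∈ Ω := fun a ha =>
    hB (mem_spectrum_of_mem_roots_charpoly ha)
  obtain ⟨p, g, hg, hfp⟩ := exists_eq_eval_add_prod_mul hΩ hf
    (B.charpoly.roots + B.charpoly.roots) fun a ha => (Multiset.mem_add.1 ha).elim
      (hroots a) (hroots a)
  rw [Multiset.map_add, Multiset.prod_add, prod_X_sub_C_roots_charpoly] at hfp
  obtain ⟨L, hL, hL'⟩ := exists_hasFDerivAt_aeval p B
  have hval : matFun f B = Polynomial.aeval B p :=
    matFun_eq_aeval_of_eq_add_mul hΩ hg hB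
      (by rw [map_mul, B.aeval_self_charpoly, mul_zero]) hfp
  refine ⟨L, ?_, fun E => ?_⟩
  · obtain ⟨c, hc⟩ := exists_eventually_norm_matFun_le hΩ hg hB
    obtain ⟨L₁, hL₁, -⟩ := exists_hasFDerivAt_aeval B.charpoly B
    have hu : (fun X => Polynomial.aeval X B.charpoly) =O[𝓝 B] fun X => ‖X - B‖ := by
      have h := hL₁.isBigO_sub.norm_right
      simp only [B.aeval_self_charpoly, sub_zero] at h
      exact h
    have hu0 : (fun X => Polynomial.aeval X B.charpoly) =o[𝓝 B] fun _ => (1 : ℝ) := by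
      rw [Asymptotics.isLittleO_one_iff]
      have h := hL₁.continuousAt.tendsto
      simp only [B.aeval_self_charpoly] at h
      exact h
    have hgO : (fun X => matFun g X) =O[𝓝 B] fun _ => (1 : ℝ) :=
      Asymptotics.isBigO_iff.2 ⟨c, by simpa using hc⟩
    have hrem := hu.mul_isLittleO (hu0.mul_isBigO hgO)
    have hrem0 : HasFDerivAt (fun X => Polynomial.aeval X B.charpoly *
        (Polynomial.aeval X B.charpoly * matFun g X)) (0 : Matrix ι ι ℂ →L[ℂ] Matrix ι ι ℂ) B := by
      refine .of_isLittleO ?_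
      simp only [mul_one] at hrem
      refine hrem.of_norm_right.congr_left fun X => ?_
      simp only [B.aeval_self_charpoly, zero_mul, sub_zero]
      exact (sub_zero _).symm
    refine (add_zero L ▸ hL.add hrem0).congr_of_eventuallyEq ?_
    filter_upwards [eventually_spectrum_subset hΩ hB] with X hX
    rw [matFun_eq_aeval_add_mul hΩ hg hX hfp, map_mul, mul_assoc]
    rfl
  · rw [hval, ← hL']
    refine matFun_eq_aeval_of_eq_add_mul hΩ hg ((spectrum_fromBlocks_subset B E).trans hB) ?_ hfp
    rw [← Matrix.charpoly_fromBlocks_zero₂₁ B E B]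
    exact Matrix.aeval_self_charpoly _

/-! ### Functions differentiable `k` times at a point -/

section TimesDifferentiableAt

variable {𝕜 : Type*} [NontriviallyNormedField 𝕜] {E : Type*} [NormedAddCommGroup E]
  [NormedSpace 𝕜 E] {F : Type*} [NormedAddCommGroup F] [NormedSpace 𝕜 F] {G : Type*}
  [NormedAddCommGroup G] [NormedSpace 𝕜 G] {k : ℕ} {g h : E → F} {x : E}

theorem timesDifferentiableAt_zero (g : E → F) (x : E) : TimesDifferentiableAt 𝕜 0 g x :=
  ⟨fun i hi => by omega, fun i hi => by omega⟩

protected theorem TimesDifferentiableAt.congr (hg : TimesDifferentiableAt 𝕜 k g x)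
    (hgh : g =ᶠ[𝓝 x] h) :
    TimesDifferentiableAt 𝕜 k h x := by
  refine ⟨fun i hi => ?_, fun i hi => ?_⟩
  · filter_upwards [hg.1 i hi, (hgh.iteratedFDeriv 𝕜 i).eventuallyEq_nhds] with y hy hy'
    exact hy.congr_of_eventuallyEq hy'.symm
  · exact (hg.2 i hi).congr_of_eventuallyEq (hgh.iteratedFDeriv 𝕜 i).symm

theorem AnalyticAt.timesDifferentiableAt [CompleteSpace F] (hg : AnalyticAt 𝕜 g x) (k : ℕ) :
    TimesDifferentiableAt 𝕜 k g x :=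
  have h (i : ℕ) : AnalyticOnNhd 𝕜 (iteratedFDeriv 𝕜 i g) {y | AnalyticAt 𝕜 g y} :=
    AnalyticOnNhd.iteratedFDeriv (fun _ hy => hy) i
  ⟨fun i _ => hg.eventually_analyticAt.mono fun y hy => (h i y hy).differentiableAt,
    fun i _ => (h i x hg).differentiableAt⟩

theorem TimesDifferentiableAt.eventually (hg : TimesDifferentiableAt 𝕜 (k + 1) g x) :
    ∀ᶠ y in 𝓝 x, TimesDifferentiableAt 𝕜 k g y := by
  have h : ∀ᶠ y in 𝓝 x, ∀ i ∈ Finset.range k,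
      ∀ᶠ w in 𝓝 y, DifferentiableAt 𝕜 (iteratedFDeriv 𝕜 i g) w :=
    (Filter.eventually_all_finset _).2 fun i hi =>
      (hg.1 i (by have := Finset.mem_range.1 hi; omega)).eventually_nhds
  filter_upwards [h] with y hy
  exact ⟨fun i hi => hy i (Finset.mem_range.2 (by omega)),
    fun i hi => (hy i (Finset.mem_range.2 (by omega))).self_of_nhds⟩

theorem TimesDifferentiableAt.mono (hg : TimesDifferentiableAt 𝕜 k g x) {l : ℕ} (hl : l ≤ k) :
    TimesDifferentiableAt 𝕜 l g x := by
  induction k, hl using Nat.le_induction with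
  | base => exact hg
  | succ k _ ih => exact ih hg.eventually.self_of_nhds

theorem differentiableAt_iteratedFDeriv_zero_iff :
    DifferentiableAt 𝕜 (iteratedFDeriv 𝕜 0 g) x ↔ DifferentiableAt 𝕜 g x := by
  rw [iteratedFDeriv_zero_eq_comp, LinearIsometryEquiv.comp_differentiableAt_iff]

theorem differentiableAt_iteratedFDeriv_succ_iff {i : ℕ} :
    DifferentiableAt 𝕜 (iteratedFDeriv 𝕜 (i + 1) g) x ↔
      DifferentiableAt 𝕜 (iteratedFDeriv 𝕜 i (fderiv 𝕜 g)) x := by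
  have h : iteratedFDeriv 𝕜 (i + 1) g = (continuousMultilinearCurryRightEquiv' 𝕜 i E F).symm ∘
      iteratedFDeriv 𝕜 i (fderiv 𝕜 g) := funext fun y => iteratedFDeriv_succ_eq_comp_right
  rw [h]
  exact LinearIsometryEquiv.comp_differentiableAt_iff (𝕜 := 𝕜) (G := E)
    (E := ContinuousMultilinearMap 𝕜 (fun _ : Fin i => E) (E →L[𝕜] F))
    (F := ContinuousMultilinearMap 𝕜 (fun _ : Fin (i + 1) => E) F)
    (continuousMultilinearCurryRightEquiv' 𝕜 i E F).symm

protected theorem TimesDifferentiableAt.differentiableAt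
    (hg : TimesDifferentiableAt 𝕜 (k + 1) g x) :
    DifferentiableAt 𝕜 g x :=
  differentiableAt_iteratedFDeriv_zero_iff.1 ((hg.mono (Nat.le_add_left 1 k)).2 0 rfl)

protected theorem TimesDifferentiableAt.fderiv (hg : TimesDifferentiableAt 𝕜 (k + 1) g x) :
    TimesDifferentiableAt 𝕜 k (fderiv 𝕜 g) x :=
  ⟨fun i hi => (hg.1 (i + 1) (by omega)).mono fun _ =>
      differentiableAt_iteratedFDeriv_succ_iff.1,
    fun i hi => differentiableAt_iteratedFDeriv_succ_iff.1 (hg.2 (i + 1) (by omega))⟩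

theorem TimesDifferentiableAt.of_fderiv (hg : DifferentiableAt 𝕜 g x)
    (hg' : 0 < k → ∀ᶠ y in 𝓝 x, DifferentiableAt 𝕜 g y)
    (hf : TimesDifferentiableAt 𝕜 k (fderiv 𝕜 g) x) :
    TimesDifferentiableAt 𝕜 (k + 1) g x := by
  refine ⟨fun i hi => ?_, fun i hi => ?_⟩
  · cases i with
    | zero => exact (hg' (by omega)).mono fun _ => differentiableAt_iteratedFDeriv_zero_iff.2
    | succ i =>
      exact (hf.1 i (by omega)).mono fun _ => differentiableAt_iteratedFDeriv_succ_iff.2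
  · cases i with
    | zero => exact differentiableAt_iteratedFDeriv_zero_iff.2 hg
    | succ i => exact differentiableAt_iteratedFDeriv_succ_iff.2 (hf.2 i (by omega))

/-- Continuity of the derivative of order `i` is not assumed, so that the corresponding statement
for functions of class `C^i` does not apply. -/
theorem iteratedFDeriv_clm_comp_eventuallyEq (L : F →L[𝕜] G) (i : ℕ)
    (hg : ∀ l < i, ∀ᶠ y in 𝓝 x, DifferentiableAt 𝕜 (iteratedFDeriv 𝕜 l g) y) :
    iteratedFDeriv 𝕜 i (fun y => L (g y)) =ᶠ[𝓝 x] fun y =>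
      ContinuousLinearMap.compContinuousMultilinearMapL 𝕜 (fun _ : Fin i => E) F G L
        (iteratedFDeriv 𝕜 i g y) := by
  induction i with
  | zero => exact .of_forall fun y => by ext m; simp
  | succ i ih =>
    filter_upwards [(ih fun l hl => hg l (by omega)).eventuallyEq_nhds, hg i (by omega)]
      with y hy hgy
    ext m
    have hL := (ContinuousLinearMap.compContinuousMultilinearMapL 𝕜 (fun _ : Fin i => E) F G
      L).hasFDerivAt.comp y hgy.hasFDerivAt
    rw [iteratedFDeriv_succ_apply_left, hy.fderiv_eq]
    refine (congrArg (fun T => T (m 0) (Fin.tail m)) hL.fderiv).trans ?_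
    simp [iteratedFDeriv_succ_apply_left]

theorem TimesDifferentiableAt.clm_comp (L : F →L[𝕜] G) (hg : TimesDifferentiableAt 𝕜 k g x) :
    TimesDifferentiableAt 𝕜 k (fun y => L (g y)) x := by
  have key (i : ℕ) (hi : i < k) := iteratedFDeriv_clm_comp_eventuallyEq L i
    fun l hl => hg.1 l (show l + 1 < k by omega)
  refine ⟨fun i hi => ?_, fun i hi => ?_⟩
  · filter_upwards [(key i (by omega)).eventuallyEq_nhds, hg.1 i hi] with y hy hgy
    exact ((ContinuousLinearMap.differentiableAt _).comp y hgy).congr_of_eventuallyEq hy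
  · exact ((ContinuousLinearMap.differentiableAt _).comp x (hg.2 i hi)).congr_of_eventuallyEq
      (key i (by omega))

/-- Continuity of the derivatives of order `i` is not assumed, so that the corresponding statement
for functions of class `C^i` does not apply. -/
theorem iteratedFDeriv_add_eventuallyEq (i : ℕ)
    (hg : ∀ l < i, ∀ᶠ y in 𝓝 x, DifferentiableAt 𝕜 (iteratedFDeriv 𝕜 l g) y)
    (hh : ∀ l < i, ∀ᶠ y in 𝓝 x, DifferentiableAt 𝕜 (iteratedFDeriv 𝕜 l h) y) :
    iteratedFDeriv 𝕜 i (fun y => g y + h y) =ᶠ[𝓝 x] fun y =>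
      iteratedFDeriv 𝕜 i g y + iteratedFDeriv 𝕜 i h y := by
  induction i with
  | zero => exact .of_forall fun y => by ext m; simp
  | succ i ih =>
    filter_upwards [(ih (fun l hl => hg l (by omega)) fun l hl => hh l (by omega)).eventuallyEq_nhds,
      hg i (by omega), hh i (by omega)] with y hy hgy hhy
    ext m
    rw [iteratedFDeriv_succ_apply_left, hy.fderiv_eq, fderiv_fun_add hgy hhy]
    simp [iteratedFDeriv_succ_apply_left]

protected theorem TimesDifferentiableAt.add (hg : TimesDifferentiableAt 𝕜 k g x)
    (hh : TimesDifferentiableAt 𝕜 k h x) : TimesDifferentiableAt 𝕜 k (fun y => g y + h y) x := by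
  have key (i : ℕ) (hi : i < k) := iteratedFDeriv_add_eventuallyEq i
    (fun l hl => hg.1 l (show l + 1 < k by omega)) fun l hl => hh.1 l (show l + 1 < k by omega)
  refine ⟨fun i hi => ?_, fun i hi => ?_⟩
  · filter_upwards [(key i (by omega)).eventuallyEq_nhds, hg.1 i hi, hh.1 i hi] with y hy hgy hhy
    exact (hgy.add hhy).congr_of_eventuallyEq hy
  · exact ((hg.2 i hi).add (hh.2 i hi)).congr_of_eventuallyEq (key i (by omega))

protected theorem TimesDifferentiableAt.sum {α : Type*} (s : Finset α) {u : α → E → F}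
    (hu : ∀ a ∈ s, TimesDifferentiableAt 𝕜 k (u a) x) :
    TimesDifferentiableAt 𝕜 k (fun y => ∑ a ∈ s, u a y) x := by
  classical
  induction s using Finset.induction_on with
  | empty =>
    have h0 (i : ℕ) : iteratedFDeriv 𝕜 i (fun _ : E => (0 : F)) = fun _ => 0 :=
      iteratedFDeriv_fun_zero
    simp only [Finset.sum_empty]
    exact ⟨fun i _ => by simp [h0], fun i _ => by simp [h0]⟩
  | insert a s ha ih =>
    simp only [Finset.sum_insert ha]
    exact (hu a (Finset.mem_insert_self a s)).add
      (ih fun b hb => hu b (Finset.mem_insert_of_mem hb))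

end TimesDifferentiableAt

/-! ### Partial derivatives -/

section PartialDeriv

variable {𝕜 : Type*} [NontriviallyNormedField 𝕜] {F : Type*} [NormedAddCommGroup F]
  [NormedSpace 𝕜 F] {G : Type*} [NormedAddCommGroup G] [NormedSpace 𝕜 G] {j k : ℕ}
  {g h : (Fin j → 𝕜) → F} {x : Fin j → 𝕜}

theorem partialDeriv_eq_fderiv (hg : DifferentiableAt 𝕜 g x) (d : Fin j) :
    partialDeriv 𝕜 d g x = fderiv 𝕜 g x (Pi.single d 1) :=
  hg.lineDeriv_eq_fderiv

theorem Filter.EventuallyEq.partialDeriv_eq (hgh : g =ᶠ[𝓝 x] h) (d : Fin j) :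
    partialDeriv 𝕜 d g x = partialDeriv 𝕜 d h x :=
  hgh.lineDeriv_eq

theorem partialDeriv_clm_comp (L : F →L[𝕜] G) (hg : DifferentiableAt 𝕜 g x) (d : Fin j) :
    partialDeriv 𝕜 d (fun y => L (g y)) x = L (partialDeriv 𝕜 d g x) := by
  have hL := L.hasFDerivAt.comp x hg.hasFDerivAt
  rw [partialDeriv_eq_fderiv hg]
  exact (partialDeriv_eq_fderiv hL.differentiableAt d).trans <|
    congrArg (fun T => T (Pi.single d 1)) hL.fderiv

theorem TimesDifferentiableAt.partialDeriv_eventuallyEq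
    (hg : TimesDifferentiableAt 𝕜 (k + 2) g x) (d : Fin j) :
    partialDeriv 𝕜 d g =ᶠ[𝓝 x] fun y => fderiv 𝕜 g y (Pi.single d 1) :=
  hg.eventually.mono fun _ hy => partialDeriv_eq_fderiv hy.differentiableAt d

theorem TimesDifferentiableAt.fderiv_apply (hg : TimesDifferentiableAt 𝕜 (k + 1) g x)
    (v : Fin j → 𝕜) : TimesDifferentiableAt 𝕜 k (fun y => fderiv 𝕜 g y v) x :=
  hg.fderiv.clm_comp (ContinuousLinearMap.apply 𝕜 F v)

protected theorem TimesDifferentiableAt.partialDeriv (hg : TimesDifferentiableAt 𝕜 (k + 1) g x)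
    (d : Fin j) : TimesDifferentiableAt 𝕜 k (partialDeriv 𝕜 d g) x := by
  cases k with
  | zero => exact timesDifferentiableAt_zero _ _
  | succ k => exact (hg.fderiv_apply _).congr (hg.partialDeriv_eventuallyEq d).symm

theorem TimesDifferentiableAt.of_partialDeriv (hg : ∀ᶠ y in 𝓝 x, DifferentiableAt 𝕜 g y)
    (hd : ∀ d : Fin j, TimesDifferentiableAt 𝕜 k (partialDeriv 𝕜 d g) x) :
    TimesDifferentiableAt 𝕜 (k + 1) g x := by
  have h := TimesDifferentiableAt.sum Finset.univ fun d _ => (hd d).clm_comp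
    (ContinuousLinearMap.smulRightL 𝕜 (Fin j → 𝕜) F (ContinuousLinearMap.proj d))
  refine .of_fderiv hg.self_of_nhds (fun _ => hg) (h.congr (hg.mono fun y hy => ?_))
  ext v
  conv_rhs => rw [pi_eq_sum_univ' v]
  simp [partialDeriv_eq_fderiv hy]

protected theorem TimesDifferentiableAt.mixedPartial {l : ℕ} (d : Fin k → Fin j)
    (hg : TimesDifferentiableAt 𝕜 (l + k) g x) :
    TimesDifferentiableAt 𝕜 l (mixedPartial 𝕜 k d g) x := by
  induction k generalizing l with
  | zero => exact hg
  | succ k ih =>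
    exact (ih (Fin.tail d) (l := l + 1) (by rwa [add_assoc, add_comm 1 k])).partialDeriv (d 0)

theorem partialDeriv_comm [IsRCLikeNormedField 𝕜] (hg : TimesDifferentiableAt 𝕜 2 g x)
    (a b : Fin j) :
    partialDeriv 𝕜 a (partialDeriv 𝕜 b g) x = partialDeriv 𝕜 b (partialDeriv 𝕜 a g) x := by
  have key (a b : Fin j) : partialDeriv 𝕜 a (partialDeriv 𝕜 b g) x =
      fderiv 𝕜 (fderiv 𝕜 g) x (Pi.single a 1) (Pi.single b 1) := by
    rw [(hg.partialDeriv_eventuallyEq b).partialDeriv_eq a]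
    exact (partialDeriv_clm_comp (ContinuousLinearMap.apply 𝕜 F (Pi.single b 1))
      hg.fderiv.differentiableAt a).trans
        (by rw [partialDeriv_eq_fderiv hg.fderiv.differentiableAt])
  rw [key, key]
  exact second_derivative_symmetric_of_eventually
    (hg.eventually.mono fun _ hy => hy.differentiableAt.hasFDerivAt)
    hg.fderiv.differentiableAt.hasFDerivAt _ _

/-- The derivative taken first may as well be taken last, by symmetry of second derivatives. -/
theorem mixedPartial_succ_eq_partialDeriv_last [IsRCLikeNormedField 𝕜] (d : Fin (k + 1) → Fin j)
    (hg : TimesDifferentiableAt 𝕜 (k + 1) g x) : mixedPartial 𝕜 (k + 1) d g x =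
      partialDeriv 𝕜 (d (Fin.last k)) (mixedPartial 𝕜 k (Fin.init d) g) x := by
  induction k generalizing x with
  | zero => rfl
  | succ k ih =>
    have h : mixedPartial 𝕜 (k + 1) (Fin.tail d) g =ᶠ[𝓝 x]
        partialDeriv 𝕜 (d (Fin.last (k + 1))) (mixedPartial 𝕜 k (Fin.init (Fin.tail d)) g) :=
      hg.eventually.mono fun y hy => ih (Fin.tail d) hy
    refine (h.partialDeriv_eq (d 0)).trans ?_
    rw [partialDeriv_comm (TimesDifferentiableAt.mixedPartial _ (by rwa [add_comm 2 k]))]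
    rfl

end PartialDeriv

/-! ### The chain rule along a path -/

section Path

variable {𝕜 : Type*} [RCLike 𝕜] [NormedAlgebra 𝕜 ℂ] {j k : ℕ} {x : Fin j → 𝕜} {ι : Type}
  [Fintype ι] {Ω : Set ℂ} {f : ℂ → ℂ}

theorem TimesDifferentiableAt.linearMap_comp {κ : Type} [Fintype κ]
    (T : Matrix ι ι ℂ →ₗ[ℂ] Matrix κ κ ℂ) {A : (Fin j → 𝕜) → Matrix ι ι ℂ}
    (hA : TimesDifferentiableAt 𝕜 k A x) :
    TimesDifferentiableAt 𝕜 k (fun y => T (A y)) x :=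
  hA.clm_comp (T.toContinuousLinearMap.restrictScalars 𝕜)

theorem partialDeriv_linearMap_comp {κ : Type} [Fintype κ]
    (T : Matrix ι ι ℂ →ₗ[ℂ] Matrix κ κ ℂ) {A : (Fin j → 𝕜) → Matrix ι ι ℂ}
    (hA : DifferentiableAt 𝕜 A x) (d : Fin j) :
    partialDeriv 𝕜 d (fun y => T (A y)) x = T (partialDeriv 𝕜 d A x) :=
  partialDeriv_clm_comp (T.toContinuousLinearMap.restrictScalars 𝕜) hA d

theorem TimesDifferentiableAt.fromBlocks {A D : (Fin j → 𝕜) → Matrix ι ι ℂ}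
    (hA : TimesDifferentiableAt 𝕜 k A x) (hD : TimesDifferentiableAt 𝕜 k D x) :
    TimesDifferentiableAt 𝕜 k (fun y => Matrix.fromBlocks (A y) (D y) 0 (A y)) x := by
  let T₁ : Matrix ι ι ℂ →ₗ[ℂ] Matrix (ι ⊕ ι) (ι ⊕ ι) ℂ :=
    { toFun := fun X => Matrix.fromBlocks X 0 0 X
      map_add' := fun X Y => by simp [Matrix.fromBlocks_add]
      map_smul' := fun c X => by simp [Matrix.fromBlocks_smul] }
  let T₂ : Matrix ι ι ℂ →ₗ[ℂ] Matrix (ι ⊕ ι) (ι ⊕ ι) ℂ :=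
    { toFun := fun X => Matrix.fromBlocks 0 X 0 0
      map_add' := fun X Y => by simp [Matrix.fromBlocks_add]
      map_smul' := fun c X => by simp [Matrix.fromBlocks_smul] }
  refine ((hA.linearMap_comp T₁).add (hD.linearMap_comp T₂)).congr (.of_forall fun y => ?_)
  simp [T₁, T₂, Matrix.fromBlocks_add]

theorem TimesDifferentiableAt.toBlocks₁₂ {A : (Fin j → 𝕜) → Matrix (ι ⊕ ι) (ι ⊕ ι) ℂ}
    (hA : TimesDifferentiableAt 𝕜 k A x) :
    TimesDifferentiableAt 𝕜 k (fun y => (A y).toBlocks₁₂) x :=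
  hA.linearMap_comp
    { toFun := fun X => X.toBlocks₁₂
      map_add' := fun _ _ => rfl
      map_smul' := fun _ _ => rfl }

/-- The chain rule for a matrix function, with the derivative expressed by a block triangular
matrix. -/
theorem matFun_fromBlocks_partialDeriv [DecidableEq ι] (hΩ : IsOpen Ω)
    (hf : DifferentiableOn ℂ f Ω) {A : (Fin j → 𝕜) → Matrix ι ι ℂ}
    (hA : DifferentiableAt 𝕜 A x) (hAx : spectrum ℂ (A x) ⊆ Ω) :
    DifferentiableAt 𝕜 (fun y => matFun f (A y)) x ∧ ∀ d : Fin j,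
      matFun f (Matrix.fromBlocks (A x) (partialDeriv 𝕜 d A x) 0 (A x)) =
        Matrix.fromBlocks (matFun f (A x)) (partialDeriv 𝕜 d (fun y => matFun f (A y)) x) 0
          (matFun f (A x)) := by
  obtain ⟨L, hL, hL'⟩ := exists_hasFDerivAt_matFun hΩ hf hAx
  have h := (hL.restrictScalars 𝕜).comp x hA.hasFDerivAt
  refine ⟨h.differentiableAt, fun d => (hL' _).trans ?_⟩
  have hd : partialDeriv 𝕜 d (fun y => matFun f (A y)) x = L (partialDeriv 𝕜 d A x) := by
    rw [partialDeriv_eq_fderiv hA]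
    exact (partialDeriv_eq_fderiv h.differentiableAt d).trans <|
      congrArg (fun T => T (Pi.single d 1)) h.fderiv
  rw [hd]

/-- The partial derivatives of `f(A(x))` are blocks of the values of `f` on a path of matrices of
twice the size, which is differentiable one time less. -/
theorem TimesDifferentiableAt.matFun_comp [DecidableEq ι] (hΩ : IsOpen Ω)
    (hf : DifferentiableOn ℂ f Ω) {A : (Fin j → 𝕜) → Matrix ι ι ℂ}
    (hA : TimesDifferentiableAt 𝕜 k A x) (hAΩ : ∀ᶠ y in 𝓝 x, spectrum ℂ (A y) ⊆ Ω) :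
    TimesDifferentiableAt 𝕜 k (fun y => matFun f (A y)) x := by
  induction k generalizing ι with
  | zero => exact timesDifferentiableAt_zero _ _
  | succ k ih =>
    cases k with
    | zero =>
      exact .of_fderiv
        (matFun_fromBlocks_partialDeriv hΩ hf hA.differentiableAt hAΩ.self_of_nhds).1
        (fun h => absurd h (lt_irrefl 0)) (timesDifferentiableAt_zero _ _)
    | succ k =>
      have key : ∀ᶠ y in 𝓝 x, DifferentiableAt 𝕜 (fun y => matFun f (A y)) y ∧ ∀ d : Fin j,
          matFun f (Matrix.fromBlocks (A y) (partialDeriv 𝕜 d A y) 0 (A y)) =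
            Matrix.fromBlocks (matFun f (A y)) (partialDeriv 𝕜 d (fun y => matFun f (A y)) y) 0
              (matFun f (A y)) := by
        filter_upwards [hA.eventually, hAΩ] with y hy hyΩ
        exact matFun_fromBlocks_partialDeriv hΩ hf hy.differentiableAt hyΩ
      refine .of_partialDeriv (key.mono fun _ hy => hy.1) fun d => ?_
      refine (ih (hA.eventually.self_of_nhds.fromBlocks (hA.partialDeriv d))
        (hAΩ.mono fun y hy => (spectrum_fromBlocks_subset _ _).trans hy)).toBlocks₁₂.congr
          (key.mono fun y hy => ?_)
      exact (congrArg Matrix.toBlocks₁₂ (hy.2 d)).trans (Matrix.toBlocks_fromBlocks₁₂ _ _ _ _)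

/-! ### The recursive block matrices -/

protected theorem TimesDifferentiableAt.blockSeq {A : (Fin j → 𝕜) → Matrix ι ι ℂ} {l : ℕ}
    (d : Fin k → Fin j) (hA : TimesDifferentiableAt 𝕜 (l + k) A x) :
    TimesDifferentiableAt 𝕜 l (blockSeq 𝕜 k d A) x := by
  induction k generalizing l with
  | zero => exact hA
  | succ k ih =>
    have h := ih (Fin.init d) (l := l + 1) (by rwa [add_assoc, add_comm 1 k])
    exact h.eventually.self_of_nhds.fromBlocks (h.partialDeriv (d (Fin.last k)))

theorem spectrum_blockSeq_subset [DecidableEq ι] (d : Fin k → Fin j)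
    (A : (Fin j → 𝕜) → Matrix ι ι ℂ) (x : Fin j → 𝕜) :
    spectrum ℂ (blockSeq 𝕜 k d A x) ⊆ spectrum ℂ (A x) := by
  induction k with
  | zero => exact subset_rfl
  | succ k ih => exact (spectrum_fromBlocks_subset _ _).trans (ih (Fin.init d))

/-- The upper right block of `blockSeq` takes the derivative in the direction `d 0` first, whereas
`mixedPartial` takes it last; the two agree because partial derivatives commute. -/
theorem submatrix_blockSeq_eq_mixedPartial (d : Fin k → Fin j) {A : (Fin j → 𝕜) → Matrix ι ι ℂ}
    (hA : TimesDifferentiableAt 𝕜 k A x) :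
    (blockSeq 𝕜 k d A x).submatrix (BlockIndex.first k) (BlockIndex.last k) =
      mixedPartial 𝕜 k d A x := by
  induction k generalizing x with
  | zero => rfl
  | succ k ih =>
    let T : Matrix (BlockIndex ι k) (BlockIndex ι k) ℂ →ₗ[ℂ] Matrix ι ι ℂ :=
      { toFun := fun X => X.submatrix (BlockIndex.first k) (BlockIndex.last k)
        map_add' := fun _ _ => rfl
        map_smul' := fun _ _ => rfl }
    have h1 : TimesDifferentiableAt 𝕜 1 (blockSeq 𝕜 k (Fin.init d) A) x :=
      TimesDifferentiableAt.blockSeq _ (by rwa [add_comm 1 k])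
    have h2 : (fun y => T (blockSeq 𝕜 k (Fin.init d) A y)) =ᶠ[𝓝 x]
        mixedPartial 𝕜 k (Fin.init d) A := hA.eventually.mono fun y hy => ih (Fin.init d) hy
    rw [mixedPartial_succ_eq_partialDeriv_last d hA, ← h2.partialDeriv_eq,
      partialDeriv_linearMap_comp T h1.differentiableAt]
    rfl

theorem matFun_blockSeq [DecidableEq ι] (hΩ : IsOpen Ω) (hf : DifferentiableOn ℂ f Ω)
    (d : Fin k → Fin j) {A : (Fin j → 𝕜) → Matrix ι ι ℂ}
    (hA : TimesDifferentiableAt 𝕜 k A x)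
    (hAΩ : ∀ᶠ y in 𝓝 x, spectrum ℂ (A y) ⊆ Ω) :
    matFun f (blockSeq 𝕜 k d A x) = blockSeq 𝕜 k d (fun y => matFun f (A y)) x := by
  induction k generalizing x with
  | zero => rfl
  | succ k ih =>
    have h1 : TimesDifferentiableAt 𝕜 1 (blockSeq 𝕜 k (Fin.init d) A) x :=
      TimesDifferentiableAt.blockSeq _ (by rwa [add_comm 1 k])
    have h2 : (fun y => matFun f (blockSeq 𝕜 k (Fin.init d) A y)) =ᶠ[𝓝 x]
        blockSeq 𝕜 k (Fin.init d) (fun y => matFun f (A y)) := by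
      filter_upwards [hA.eventually, hAΩ.eventually_nhds] with y hy hyΩ
      exact ih (Fin.init d) hy hyΩ
    obtain ⟨-, h3⟩ := matFun_fromBlocks_partialDeriv hΩ hf h1.differentiableAt
      ((spectrum_blockSeq_subset (Fin.init d) A x).trans hAΩ.self_of_nhds)
    have h4 := h3 (d (Fin.last k))
    rw [h2.partialDeriv_eq, ih _ hA.eventually.self_of_nhds hAΩ] at h4
    exact h4

end Path

/-! ### Jordan blocks of size one -/

theorem aeval_mul_mul_of_mul_eq_one {ι κ : Type*} [Fintype ι] [DecidableEq ι] [Fintype κ]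
    [DecidableEq κ] {P : Matrix ι κ ℂ} {Q : Matrix κ ι ℂ} (hPQ : P * Q = 1) (hQP : Q * P = 1)
    (D : Matrix κ κ ℂ) (p : Polynomial ℂ) :
    Polynomial.aeval (P * D * Q) p = P * Polynomial.aeval D p * Q := by
  induction p using Polynomial.induction_on with
  | C a =>
    simp [Algebra.algebraMap_eq_smul_one, hPQ]
  | add p q hp hq => simp [hp, hq, Matrix.mul_add, Matrix.add_mul]
  | monomial n a ih =>
    have hp : Polynomial.C a * Polynomial.X ^ (n + 1) =
        Polynomial.C a * Polynomial.X ^ n * Polynomial.X := by ring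
    rw [hp, map_mul, ih, map_mul _ _ Polynomial.X, Polynomial.aeval_X, Polynomial.aeval_X]
    simp only [← Matrix.mul_assoc]
    rw [Matrix.mul_assoc _ Q P, hQP, Matrix.mul_one]

theorem aeval_diagonal {κ : Type*} [Fintype κ] [DecidableEq κ] (v : κ → ℂ) (p : Polynomial ℂ) :
    Polynomial.aeval (Matrix.diagonal v) p = Matrix.diagonal fun i => p.eval (v i) := by
  have h := Polynomial.aeval_algHom_apply (Matrix.diagonalAlgHom (n := κ) (α := ℂ) ℂ) v p
  rw [Matrix.diagonalAlgHom_apply, Matrix.diagonalAlgHom_apply] at h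
  rw [h]
  congr 1
  funext i
  rw [← Polynomial.coe_aeval_eq_eval]
  exact (Polynomial.aeval_algHom_apply (Pi.evalAlgHom ℂ (fun _ : κ => ℂ) i) v p).symm

/-- A matrix whose Jordan blocks have size at most one is diagonalizable, so that its minimal
polynomial has simple roots. -/
theorem eigIndex_le_one_of_mem_jordanClass {ι : Type*} [Fintype ι] [DecidableEq ι] {Ω : Set ℂ}
    {A : Matrix ι ι ℂ} (hA : A ∈ jordanClass ι Ω 1) (a : ℂ) : eigIndex A a ≤ 1 := by
  obtain ⟨-, r, s, lam, ⟨P, Q, hPQ, hQP, rfl⟩, hs⟩ := hA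
  have hD : Matrix.blockDiagonal' (fun i => jordanBlock (s i) (lam i)) =
      Matrix.diagonal fun t : Σ i, Fin (s i) => lam t.1 := by
    have hblock (i : Fin r) :
        jordanBlock (s i) (lam i) = Matrix.diagonal fun _ : Fin (s i) => lam i := by
      ext p q
      have hpq : p = q := Fin.ext (by have := hs i; omega)
      simp [jordanBlock, hpq]
    simp only [hblock]
    exact Matrix.blockDiagonal'_diagonal _
  let q : Polynomial ℂ := ((Finset.univ.image lam).val.map
    fun b => Polynomial.X - Polynomial.C b).prod
  have hq : q.roots = (Finset.univ.image lam).val := Polynomial.roots_multiset_prod_X_sub_C _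
  have hq0 : q ≠ 0 := (Polynomial.monic_multiset_prod_of_monic _ _
    fun b _ => Polynomial.monic_X_sub_C b).ne_zero
  have hroot (i : Fin r) : q.eval (lam i) = 0 := by
    refine Polynomial.isRoot_of_mem_roots (p := q) ?_
    rw [hq]
    exact Finset.mem_image_of_mem lam (Finset.mem_univ i)
  have hdvd : minpoly ℂ (P * Matrix.blockDiagonal' (fun i => jordanBlock (s i) (lam i)) * Q) ∣
      q := by
    refine minpoly.dvd _ _ ?_
    rw [aeval_mul_mul_of_mul_eq_one hPQ hQP, hD, aeval_diagonal]
    simp [hroot]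
  refine (Polynomial.rootMultiplicity_le_rootMultiplicity_of_dvd hq0 hdvd a).trans ?_
  rw [← Polynomial.count_roots, hq]
  exact Multiset.nodup_iff_count_le_one.1 (Finset.nodup _) a

/-! ### The mixed derivatives of a matrix function -/

theorem theorem2p1 {𝕜 : Type*} [RCLike 𝕜] [NormedAlgebra 𝕜 ℂ] (n m k j : ℕ) (hm : 1 ≤ m)
    (Ω : Set ℂ) (hΩ : IsOpen Ω) (f : ℂ → ℂ)
    (hf : ContDiffOn ℂ (((k + 1) * m - 1 : ℕ) : WithTop ℕ∞) f Ω)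
    (A : (Fin j → 𝕜) → Matrix (Fin n) (Fin n) ℂ) (xbar : Fin j → 𝕜)
    (hA : TimesDifferentiableAt 𝕜 k A xbar)
    (hAΩ : ∀ᶠ x in 𝓝 xbar, A x ∈ jordanClass (Fin n) Ω m) :
    TimesDifferentiableAt 𝕜 k (fun x => matFun f (A x)) xbar ∧
    ∀ d : Fin k → Fin j,
      DefinedOnSpectrum Ω f (blockSeq 𝕜 k d A xbar) ∧
      matFun f (blockSeq 𝕜 k d A xbar) = blockSeq 𝕜 k d (fun x => matFun f (A x)) xbar ∧
      (Matrix.of fun p q : Fin n =>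
        matFun f (blockSeq 𝕜 k d A xbar) (BlockIndex.first k p) (BlockIndex.last k q)) =
        mixedPartial 𝕜 k d (fun x => matFun f (A x)) xbar := by
  have hspec : ∀ᶠ x in 𝓝 xbar, spectrum ℂ (A x) ⊆ Ω := hAΩ.mono fun _ hx => hx.1
  by_cases h0 : (k + 1) * m - 1 = 0
  · -- here `k = 0` and `m = 1`: `f` is merely continuous, and `A` is diagonalizable near `xbar`
    have hle : (k + 1) * 1 ≤ (k + 1) * m := Nat.mul_le_mul_left _ hm
    obtain rfl : k = 0 := by omega
    obtain rfl : m = 1 := by omega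
    refine ⟨timesDifferentiableAt_zero _ _, fun d => ⟨⟨hspec.self_of_nhds, fun a _ => ?_⟩,
      rfl, rfl⟩⟩
    have h1 : eigIndex (A xbar) a ≤ 1 := eigIndex_le_one_of_mem_jordanClass hAΩ.self_of_nhds a
    have h2 : eigIndex (blockSeq 𝕜 0 d A xbar) a - 1 = 0 := Nat.sub_eq_zero_of_le h1
    rw [h2]
    exact timesDifferentiableAt_zero _ _
  · have hf' : DifferentiableOn ℂ f Ω := hf.differentiableOn (by exact_mod_cast h0)
    have hF := hA.matFun_comp hΩ hf' hspec
    refine ⟨hF, fun d => ?_⟩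
    have hX := (spectrum_blockSeq_subset d A xbar).trans hspec.self_of_nhds
    have hval := matFun_blockSeq hΩ hf' d hA hspec
    refine ⟨⟨hX, fun a ha =>
      (hf'.analyticAt (hΩ.mem_nhds (hX ha))).timesDifferentiableAt _⟩, hval, ?_⟩
    rw [hval]
    exact submatrix_blockSeq_eq_mixedPartial d hF
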